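/- Let $V$ be a set of $n$ points in the Euclidean plane. For each $x\in V$, let $B_x$ be the closed disk centered at $x$ whose radius is the distance from $x$ to the nearest other point of $V$. The closed sphere of influence graph on $V$ is the simple undirected graph with vertex set $V$ in which two distinct points $x,y\in V$ are adjacent if and only if $B_x\cap B_y\neq\emptyset$. Then this graph has at most $14.5\,n$ edges. (If $n=1$, the radius is undefined, but the graph has no edges under any convention.) -/

import Mathlib

/-- The Euclidean plane. -/
abbrev Plane : Type := EuclideanSpace ℝ (Fin 2)

/-- The radius of the sphere of influence of a point `x` of a finite planar point set `V`: the
distance from `x` to its nearest neighbor, i.e. to the set of the other points of `V`.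
(If `x` is the only point of `V`, there is no neighbor and the value is `0`; the graph below then
has a single vertex and no edge, whatever the convention.) -/
noncomputable def influenceRadius (V : Finset Plane) (x : Plane) : ℝ :=
  Metric.infDist x ((V : Set Plane) \ {x})

/-- The sphere of influence of `x` in `V`: the closed disk centered at `x` whose radius is the
distance from `x` to its nearest neighbor in `V`. -/
noncomputable def influenceBall (V : Finset Plane) (x : Plane) : Set Plane :=
  Metric.closedBall x (influenceRadius V x)

/-- The closed sphere of influence graph on a finite planar point set `V`: distinct points of `V`
are adjacent if and only if their spheres of influence intersect. -/
noncomputable def closedSphereOfInfluenceGraph (V : Finset Plane) : SimpleGraph V where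
  Adj x y := x ≠ y ∧ (influenceBall V x ∩ influenceBall V y).Nonempty
  symm := ⟨fun x y h => ⟨h.1.symm, by rw [Set.inter_comm]; exact h.2⟩⟩
  loopless := ⟨fun _ h => h.1 rfl⟩

open MeasureTheory

/-! Charge each edge to its two ends: `x` pays `edgeShare` of the ratio ρ of the other radius to its
own, and the two payments total at least 1. It remains to bound what `x` pays. Scale its radius to 1
and split the neighbors with ρ ≥ 2/5 at distance `layerCutoff ρ` into inner and outer ones. Two
neighbors are at least the larger of their radii apart, so by the law of cosines two in one layer
with shares w, w' are seen from `x` at an angle above (w + w') g, where g = 4/7 (inner) or 7/20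
(outer). Arcs of half-width w g are then disjoint, so a layer pays at most π / g; and 7π/4 + 20π/7 <
14.5. -/

/-! ### Packing arcs on a circle. -/

/-- Closed arcs of half-widths `h i` on the circle of length `2π` that are pairwise disjoint have
total half-width at most `π`. -/
theorem sum_halfWidth_le_pi {ι : Type*} (S : Finset ι) (α : ι → AddCircle (2 * Real.pi))
    (h : ι → ℝ) (hpi : ∀ i ∈ S, h i ≤ Real.pi) (h0 : ∀ i ∈ S, 0 ≤ h i)
    (hsep : ∀ i ∈ S, ∀ j ∈ S, i ≠ j → h i + h j < dist (α i) (α j)) :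
    ∑ i ∈ S, h i ≤ Real.pi := by
  have : Fact (0 < 2 * Real.pi) := ⟨Real.two_pi_pos⟩
  have hdisj : (S : Set ι).PairwiseDisjoint (fun i => Metric.closedBall (α i) (h i)) :=
    fun i hi j hj hij => Metric.closedBall_disjoint_closedBall (hsep i hi j hj hij)
  have hvol : ∑ i ∈ S, volume (Metric.closedBall (α i) (h i)) ≤ ENNReal.ofReal (2 * Real.pi) := by
    rw [← measure_biUnion_finset hdisj fun i _ => Metric.isClosed_closedBall.measurableSet,
      ← AddCircle.measure_univ (2 * Real.pi)]
    exact measure_mono (Set.subset_univ _)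
  have hball : ∀ i ∈ S, volume (Metric.closedBall (α i) (h i)) = ENNReal.ofReal (2 * h i) := by
    intro i hi
    rw [AddCircle.volume_closedBall, min_eq_right (by linarith [hpi i hi])]
  rw [Finset.sum_congr rfl hball,
    ← ENNReal.ofReal_sum_of_nonneg (fun i hi => by linarith [h0 i hi]),
    ENNReal.ofReal_le_ofReal_iff Real.two_pi_pos.le, ← Finset.mul_sum] at hvol
  linarith

/-- The law of cosines in terms of arguments of complex numbers. -/
theorem Complex.norm_sub_sq_eq_cos_arg_sub (z w : ℂ) :
    ‖z - w‖ ^ 2 = (‖z‖ - ‖w‖) ^ 2 + ‖z‖ * ‖w‖ * (2 - 2 * Real.cos (z.arg - w.arg)) := by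
  have hz := Complex.norm_mul_cos_arg z
  have hz' := Complex.norm_mul_sin_arg z
  have hw := Complex.norm_mul_cos_arg w
  have hw' := Complex.norm_mul_sin_arg w
  rw [Real.cos_sub, Complex.sq_norm, Complex.normSq_apply, Complex.sub_re, Complex.sub_im,
    ← hz, ← hz', ← hw, ← hw']
  linear_combination ‖z‖ ^ 2 * Real.sin_sq_add_cos_sq z.arg +
    ‖w‖ ^ 2 * Real.sin_sq_add_cos_sq w.arg

/-- A lower bound for the chord gives a lower bound for the arc. -/
theorem lt_norm_coe_of_sq_lt {φ H : ℝ} (hH : H ^ 2 < 2 - 2 * Real.cos φ) :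
    H < ‖(φ : AddCircle (2 * Real.pi))‖ := by
  rw [AddCircle.norm_eq]
  set k : ℤ := round ((2 * Real.pi)⁻¹ * φ)
  have hcos : Real.cos (φ - k * (2 * Real.pi)) = Real.cos φ := Real.cos_sub_int_mul_two_pi φ k
  -- The norm is the absolute value of this representative, and 2 - 2 cos t ≤ t²: a chord is no
  -- longer than its arc.
  have hsq := Real.one_sub_sq_div_two_le_cos (x := φ - k * (2 * Real.pi))
  refine lt_of_le_of_lt (le_abs_self H) (sq_lt_sq.mp ?_)
  linarith

/-- Weighted points in the plane that are pairwise separated, as seen from the origin, by angles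
proportional to the sums of their weights have bounded total weight. -/
theorem sum_weight_mul_le_pi {ι : Type*} (S : Finset ι) (z : ι → ℂ) (w : ι → ℝ) {g : ℝ}
    (hpi : ∀ i ∈ S, w i * g ≤ Real.pi) (h0 : ∀ i ∈ S, 0 ≤ w i * g)
    (hz : ∀ i ∈ S, 1 ≤ ‖z i‖)
    (hsep : ∀ i ∈ S, ∀ j ∈ S, i ≠ j →
      (‖z i‖ - ‖z j‖) ^ 2 + ((w i + w j) * g) ^ 2 * (‖z i‖ * ‖z j‖) < ‖z i - z j‖ ^ 2) :
    (∑ i ∈ S, w i) * g ≤ Real.pi := by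
  rw [Finset.sum_mul]
  refine sum_halfWidth_le_pi S (fun i => ((z i).arg : AddCircle (2 * Real.pi))) _ hpi h0 ?_
  intro i hi j hj hij
  rw [dist_eq_norm, ← AddCircle.coe_sub]
  apply lt_norm_coe_of_sq_lt
  have h := hsep i hi j hj hij
  rw [Complex.norm_sub_sq_eq_cos_arg_sub] at h
  have hpos : 0 < ‖z i‖ * ‖z j‖ :=
    mul_pos (by linarith [hz i hi]) (by linarith [hz j hj])
  rw [← add_mul]
  refine lt_of_mul_lt_mul_left ?_ hpos.le
  linarith

/-! ### Reducing separation to corner checks. -/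

/-- A monic quadratic polynomial is bounded on an interval by its values at the endpoints. -/
theorem sq_add_mul_add_lt_of_endpoints {a b s p q M : ℝ} (has : a ≤ s) (hsb : s ≤ b)
    (ha : a ^ 2 + p * a + q < M) (hb : b ^ 2 + p * b + q < M) : s ^ 2 + p * s + q < M := by
  rcases le_total 0 (s + b + p) with h | h
  -- The value at b minus the value at s is (b - s)(s + b + p).
  · nlinarith [mul_nonneg (sub_nonneg.2 hsb) h]
  · nlinarith [mul_nonneg (sub_nonneg.2 has) (sub_nonneg.2 (show s + a + p ≤ 0 by linarith))]

/-- The separation condition on a rectangle of distances follows from that at the corners. -/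
theorem separation_of_corners {a b a' b' s t c M : ℝ} (has : a ≤ s) (hsb : s ≤ b)
    (hat : a' ≤ t) (htb : t ≤ b')
    (h₁ : (a - a') ^ 2 + c * (a * a') < M) (h₂ : (a - b') ^ 2 + c * (a * b') < M)
    (h₃ : (b - a') ^ 2 + c * (b * a') < M) (h₄ : (b - b') ^ 2 + c * (b * b') < M) :
    (s - t) ^ 2 + c * (s * t) < M := by
  have key : ∀ u, (u - a') ^ 2 + c * (u * a') < M → (u - b') ^ 2 + c * (u * b') < M →
      (u - t) ^ 2 + c * (u * t) < M := by
    intro u hu hu'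
    have := sq_add_mul_add_lt_of_endpoints (p := c * u - 2 * u) (q := u ^ 2) (M := M) hat htb
      (by linarith) (by linarith)
    linarith
  have := sq_add_mul_add_lt_of_endpoints (p := c * t - 2 * t) (q := t ^ 2) (M := M) has hsb
    (by linarith [key a h₁ h₂]) (by linarith [key b h₃ h₄])
  linarith

/-- The separation condition for two points at distances in `[a, 1 + R]` and `[a', 1 + R]` from the
origin and at mutual distance at least `R`, where `R` is bounded below by `L`. -/
theorem separation_of_le_one_add {a a' s t c L R : ℝ} (hL : 0 ≤ L) (hR : L ≤ R)
    (has : a ≤ s) (hs : s ≤ 1 + R) (hat : a' ≤ t) (ht : t ≤ 1 + R)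
    (ha : c * a ≤ 2 * (a - 1)) (ha' : c * a' ≤ 2 * (a' - 1)) (hcL : c * (1 + L) ≤ L)
    (h₁ : (a - a') ^ 2 + c * (a * a') < L ^ 2)
    (h₂ : (a - (1 + L)) ^ 2 + c * (a * (1 + L)) < L ^ 2)
    (h₃ : ((1 + L) - a') ^ 2 + c * ((1 + L) * a') < L ^ 2)
    (h₄ : c * ((1 + L) * (1 + L)) < L ^ 2) :
    (s - t) ^ 2 + c * (s * t) < R ^ 2 := by
  have hc1 : c ≤ 1 := by nlinarith
  -- At each corner, left side minus R² is nonincreasing in R ≥ L, by `ha`, `ha'`, `hcL` and c ≤ 1,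
  -- so R = L is the worst case.
  refine separation_of_corners has hs hat ht ?_ ?_ ?_ ?_
  · nlinarith
  · nlinarith [mul_nonneg (sub_nonneg.2 hR) (sub_nonneg.2 ha)]
  · nlinarith [mul_nonneg (sub_nonneg.2 hR) (sub_nonneg.2 ha')]
  · nlinarith [mul_nonneg (sub_nonneg.2 hR) (sub_nonneg.2 hcL),
      mul_nonneg (mul_nonneg (sub_nonneg.2 hR) (sub_nonneg.2 hR)) (sub_nonneg.2 hc1)]

/-! ### Shares and the two layers. -/

/-- The share of an edge that is charged to an endpoint `x`, as a function of the ratio of the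
radius at the other endpoint to the radius at `x`. -/
noncomputable def edgeShare (ρ : ℝ) : ℝ :=
  if ρ < 2 / 5 then 0 else if ρ < 3 / 4 then 1 / 4 else if ρ < 4 / 3 then 1 / 2
  else if ρ < 5 / 2 then 3 / 4 else 1

/-- The distance from `x`, in terms of the ratio of radii, that separates the inner neighbors of
`x` from the outer ones, when the radius at `x` is `1`. -/
noncomputable def layerCutoff (ρ : ℝ) : ℝ :=
  if ρ < 3 / 4 then 6 / 5 else if ρ < 4 / 3 then 9 / 7 else if ρ < 5 / 2 then 3 / 2 else 5 / 2

theorem edgeShare_nonneg (ρ : ℝ) : 0 ≤ edgeShare ρ := by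
  unfold edgeShare; split_ifs <;> norm_num

theorem edgeShare_le_one (ρ : ℝ) : edgeShare ρ ≤ 1 := by
  unfold edgeShare; split_ifs <;> norm_num

theorem le_of_edgeShare_ne_zero {ρ : ℝ} (h : edgeShare ρ ≠ 0) : 2 / 5 ≤ ρ := by
  by_contra! hlt
  exact h (if_pos hlt)

/-- The thresholds form reciprocal pairs, so the sum is exactly 1, except at the thresholds
themselves, where the half-open intervals make it 5/4. -/
theorem one_le_edgeShare_add_inv {ρ : ℝ} (hρ : 0 < ρ) :
    1 ≤ edgeShare ρ + edgeShare ρ⁻¹ := by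
  have h₁ : ρ⁻¹ < 2 / 5 → 5 / 2 < ρ := fun h => by
    rw [inv_lt_comm₀ hρ (by norm_num)] at h; norm_num at h; exact h
  have h₂ : ρ⁻¹ < 3 / 4 → 4 / 3 < ρ := fun h => by
    rw [inv_lt_comm₀ hρ (by norm_num)] at h; norm_num at h; exact h
  have h₃ : ρ⁻¹ < 4 / 3 → 3 / 4 < ρ := fun h => by
    rw [inv_lt_comm₀ hρ (by norm_num)] at h; norm_num at h; exact h
  have h₄ : ρ⁻¹ < 5 / 2 → 2 / 5 < ρ := fun h => by
    rw [inv_lt_comm₀ hρ (by norm_num)] at h; norm_num at h; exact h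
  unfold edgeShare
  split_ifs <;> first | (norm_num; done) | (exfalso; grind)

/-- The values of `edgeShare` and `layerCutoff` on the four classes of ratios that count. -/
theorem edgeShare_layerCutoff_cases {ρ : ℝ} (hρ : 2 / 5 ≤ ρ) :
    (2 / 5 ≤ ρ ∧ ρ < 3 / 4 ∧ edgeShare ρ = 1 / 4 ∧ layerCutoff ρ = 6 / 5) ∨
    (3 / 4 ≤ ρ ∧ ρ < 4 / 3 ∧ edgeShare ρ = 1 / 2 ∧ layerCutoff ρ = 9 / 7) ∨
    (4 / 3 ≤ ρ ∧ ρ < 5 / 2 ∧ edgeShare ρ = 3 / 4 ∧ layerCutoff ρ = 3 / 2) ∨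
    (5 / 2 ≤ ρ ∧ edgeShare ρ = 1 ∧ layerCutoff ρ = 5 / 2) := by
  unfold edgeShare layerCutoff
  rw [if_neg hρ.not_gt]
  rcases lt_or_ge ρ (3 / 4) with h₁ | h₁
  · exact Or.inl ⟨hρ, h₁, if_pos h₁, if_pos h₁⟩
  rw [if_neg h₁.not_gt, if_neg h₁.not_gt]
  rcases lt_or_ge ρ (4 / 3) with h₂ | h₂
  · exact Or.inr (Or.inl ⟨h₁, h₂, if_pos h₂, if_pos h₂⟩)
  rw [if_neg h₂.not_gt, if_neg h₂.not_gt]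
  rcases lt_or_ge ρ (5 / 2) with h₃ | h₃
  · exact Or.inr (Or.inr (Or.inl ⟨h₂, h₃, if_pos h₃, if_pos h₃⟩))
  · exact Or.inr (Or.inr (Or.inr ⟨h₃, if_neg h₃.not_gt, if_neg h₃.not_gt⟩))

/-- Two inner neighbors of a point of radius `1` are separated by a large angle. -/
theorem separation_inner {R R' s t : ℝ} (hR : 2 / 5 ≤ R) (hRR' : R ≤ R')
    (hs : 1 ≤ s) (ht : 1 ≤ t) (hRs : R ≤ s) (hRt : R' ≤ t)
    (hsδ : s < layerCutoff R) (htδ : t < layerCutoff R') :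
    (s - t) ^ 2 + ((edgeShare R + edgeShare R') * (4 / 7)) ^ 2 * (s * t) < R' ^ 2 := by
  have sq_le : ∀ L : ℝ, 0 ≤ L → L ≤ R' → L ^ 2 ≤ R' ^ 2 := fun L h h' => pow_le_pow_left₀ h h' 2
  rcases edgeShare_layerCutoff_cases hR with ⟨h₁, h₂, hw, hδ⟩ | ⟨h₁, h₂, hw, hδ⟩ |
      ⟨h₁, h₂, hw, hδ⟩ | ⟨h₁, hw, hδ⟩ <;>
    rcases edgeShare_layerCutoff_cases (hR.trans hRR') with ⟨h₁', h₂', hw', hδ'⟩ |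
      ⟨h₁', h₂', hw', hδ'⟩ | ⟨h₁', h₂', hw', hδ'⟩ | ⟨h₁', hw', hδ'⟩ <;>
    rw [hδ] at hsδ <;> rw [hδ'] at htδ <;> rw [hw, hw'] <;>
    first
    -- Besides R' in a lower class than R, this excludes the top class: there 5/2 ≤ R' ≤ t, so no
    -- such neighbor is inner.
    | (exfalso; linarith)
    | (refine lt_of_lt_of_le ?_ (sq_le _ (by norm_num) h₁')
       first
       | (refine separation_of_corners (h₁.trans hRs) hsδ.le (h₁'.trans hRt) htδ.le ?_ ?_ ?_ ?_ <;>
           (norm_num; done))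
       | (refine separation_of_corners hs hsδ.le (h₁'.trans hRt) htδ.le ?_ ?_ ?_ ?_ <;>
           (norm_num; done))
       | (refine separation_of_corners hs hsδ.le ht htδ.le ?_ ?_ ?_ ?_ <;>
           norm_num))

/-- Two outer neighbors of a point of radius `1` are separated by a large angle. -/
theorem separation_outer {R R' s t : ℝ} (hR : 2 / 5 ≤ R) (hRR' : R ≤ R')
    (hs : s ≤ 1 + R) (ht : t ≤ 1 + R')
    (hsδ : layerCutoff R ≤ s) (htδ : layerCutoff R' ≤ t) :
    (s - t) ^ 2 + ((edgeShare R + edgeShare R') * (7 / 20)) ^ 2 * (s * t) < R' ^ 2 := by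
  -- Only R' bounds the mutual distance, so both points are put under the common bound 1 + R'.
  have hs' : s ≤ 1 + R' := by linarith
  rcases edgeShare_layerCutoff_cases hR with ⟨h₁, h₂, hw, hδ⟩ | ⟨h₁, h₂, hw, hδ⟩ |
      ⟨h₁, h₂, hw, hδ⟩ | ⟨h₁, hw, hδ⟩ <;>
    rcases edgeShare_layerCutoff_cases (hR.trans hRR') with ⟨h₁', h₂', hw', hδ'⟩ |
      ⟨h₁', h₂', hw', hδ'⟩ | ⟨h₁', h₂', hw', hδ'⟩ | ⟨h₁', hw', hδ'⟩ <;>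
    rw [hδ] at hsδ <;> rw [hδ'] at htδ <;> rw [hw, hw'] <;>
    first
    | (exfalso; linarith)
    | exact separation_of_le_one_add (by norm_num) h₁' hsδ hs' htδ ht (by norm_num)
        (by norm_num) (by norm_num) (by norm_num) (by norm_num) (by norm_num) (by norm_num)

/-- The total share charged to a point of radius `1` at the origin by its neighbors `z i` of
radii `ρ i`. -/
theorem sum_edgeShare_le {ι : Type*} (S : Finset ι) (z : ι → ℂ) (ρ : ι → ℝ)
    (hone : ∀ i ∈ S, 1 ≤ ‖z i‖) (hρ : ∀ i ∈ S, ρ i ≤ ‖z i‖) (hadj : ∀ i ∈ S, ‖z i‖ ≤ 1 + ρ i)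
    (hdist : ∀ i ∈ S, ∀ j ∈ S, i ≠ j → ρ j ≤ ‖z i - z j‖) :
    ∑ i ∈ S, edgeShare (ρ i) ≤ 14.5 := by
  classical
  have layer : ∀ (T : Finset ι) (g : ℝ), T ⊆ S → 0 < g → g ≤ 1 →
      (∀ i ∈ T, ∀ j ∈ T, 2 / 5 ≤ ρ i → ρ i ≤ ρ j →
        (‖z i‖ - ‖z j‖) ^ 2 + ((edgeShare (ρ i) + edgeShare (ρ j)) * g) ^ 2 * (‖z i‖ * ‖z j‖)
          < ρ j ^ 2) →
      (∑ i ∈ T, edgeShare (ρ i)) * g ≤ Real.pi := by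
    intro T g hTS hg hg1 hsep
    -- Neighbors with ρ < 2/5 pay nothing and need not be separated.
    rw [← Finset.sum_filter_ne_zero]
    refine sum_weight_mul_le_pi _ z _ ?_ ?_ ?_ ?_
    · intro i _
      have := mul_le_one₀ (edgeShare_le_one (ρ i)) hg.le hg1
      linarith [Real.pi_gt_three]
    · intro i _
      exact mul_nonneg (edgeShare_nonneg _) hg.le
    · intro i hi
      exact hone i (hTS (Finset.mem_filter.1 hi).1)
    · intro i hi j hj hij
      obtain ⟨hi, hi'⟩ := Finset.mem_filter.1 hi
      obtain ⟨hj, hj'⟩ := Finset.mem_filter.1 hj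
      have hi' := le_of_edgeShare_ne_zero hi'
      have hj' := le_of_edgeShare_ne_zero hj'
      rcases le_total (ρ i) (ρ j) with hle | hle
      · exact (hsep i hi j hj hi' hle).trans_le
          (pow_le_pow_left₀ (by linarith) (hdist i (hTS hi) j (hTS hj) hij) 2)
      · have h := (hsep j hj i hi hj' hle).trans_le
          (pow_le_pow_left₀ (by linarith) (hdist j (hTS hj) i (hTS hi) hij.symm) 2)
        rw [norm_sub_rev, sub_sq_comm, mul_comm ‖z i‖, add_comm (edgeShare (ρ i))]
        exact h
  have hin := layer (S.filter fun i => ‖z i‖ < layerCutoff (ρ i)) (4 / 7)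
    (Finset.filter_subset _ _) (by norm_num) (by norm_num) (by
      intro i hi j hj h₀ hle
      obtain ⟨hi, hi'⟩ := Finset.mem_filter.1 hi
      obtain ⟨hj, hj'⟩ := Finset.mem_filter.1 hj
      exact separation_inner h₀ hle (hone i hi) (hone j hj) (hρ i hi) (hρ j hj) hi' hj')
  have hout := layer (S.filter fun i => ¬ ‖z i‖ < layerCutoff (ρ i)) (7 / 20)
    (Finset.filter_subset _ _) (by norm_num) (by norm_num) (by
      intro i hi j hj h₀ hle
      obtain ⟨hi, hi'⟩ := Finset.mem_filter.1 hi
      obtain ⟨hj, hj'⟩ := Finset.mem_filter.1 hj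
      exact separation_outer h₀ hle (hadj i hi) (hadj j hj) (not_lt.1 hi') (not_lt.1 hj'))
  rw [← Finset.sum_filter_add_sum_filter_not S fun i => ‖z i‖ < layerCutoff (ρ i)]
  -- The total is at most 129π/28 ≈ 14.474.
  linarith [Real.pi_lt_d4]

/-! ### Double counting and the graph itself. -/

/-- Counting edges of a graph by charging each of them to its endpoints. -/
theorem SimpleGraph.ncard_edgeSet_le_of_share {W : Type*} [Fintype W] (G : SimpleGraph W)
    [DecidableRel G.Adj] (f : W → W → ℝ) {c : ℝ}
    (hf : ∀ x y, G.Adj x y → 1 ≤ f x y + f y x)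
    (hc : ∀ x, ∑ y ∈ G.neighborFinset x, f x y ≤ c) :
    (G.edgeSet.ncard : ℝ) ≤ c * Fintype.card W := by
  classical
  have hcard : G.edgeSet.ncard = G.edgeFinset.card := by
    rw [← SimpleGraph.coe_edgeFinset, Set.ncard_coe_finset]
  have hdeg : (2 * G.edgeFinset.card : ℝ) = ∑ x, ∑ y ∈ G.neighborFinset x, (1 : ℝ) := by
    have h := G.sum_degrees_eq_twice_card_edges
    simp only [Finset.sum_const, nsmul_eq_mul, mul_one, SimpleGraph.card_neighborFinset_eq_degree]
    exact_mod_cast h.symm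
  have hswap : ∑ x, ∑ y ∈ G.neighborFinset x, f y x = ∑ x, ∑ y ∈ G.neighborFinset x, f x y :=
    Finset.sum_comm' fun x y => by simp [G.adj_comm x y]
  have hle : ∑ x, ∑ y ∈ G.neighborFinset x, (1 : ℝ) ≤
      ∑ x, ∑ y ∈ G.neighborFinset x, (f x y + f y x) :=
    Finset.sum_le_sum fun x _ => Finset.sum_le_sum fun y hy =>
      hf x y ((G.mem_neighborFinset x y).1 hy)
  simp only [Finset.sum_add_distrib, hswap] at hle
  have htot : ∑ x, ∑ y ∈ G.neighborFinset x, f x y ≤ c * Fintype.card W := by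
    refine (Finset.sum_le_sum fun x _ => hc x).trans_eq ?_
    simp [mul_comm]
  rw [hcard]
  linarith

theorem influenceRadius_le_dist {V : Finset Plane} {x y : Plane} (hy : y ∈ V) (hxy : x ≠ y) :
    influenceRadius V x ≤ dist x y :=
  Metric.infDist_le_dist_of_mem ⟨hy, hxy.symm⟩

theorem influenceRadius_pos {V : Finset Plane} {x y : Plane} (hy : y ∈ V) (hxy : x ≠ y) :
    0 < influenceRadius V x := by
  have hclosed : IsClosed ((V : Set Plane) \ {x}) :=
    (V.finite_toSet.subset Set.sdiff_subset).isClosed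
  exact (hclosed.notMem_iff_infDist_pos ⟨y, hy, hxy.symm⟩).1 fun h => h.2 rfl

theorem dist_le_of_adj {V : Finset Plane} {x y : V}
    (h : (closedSphereOfInfluenceGraph V).Adj x y) :
    dist (x : Plane) y ≤ influenceRadius V x + influenceRadius V y := by
  obtain ⟨-, p, hx, hy⟩ := h
  exact (dist_triangle_left _ _ p).trans (add_le_add hx hy)

theorem theorem1p2 (n : ℕ) (V : Finset Plane) (hV : V.card = n) :
    ((closedSphereOfInfluenceGraph V).edgeSet.ncard : ℝ) ≤ 14.5 * (n : ℝ) := by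
  classical
  have key := (closedSphereOfInfluenceGraph V).ncard_edgeSet_le_of_share (c := 14.5)
    (fun x y => edgeShare (influenceRadius V y / influenceRadius V x)) ?_ ?_
  · rwa [Fintype.card_coe, hV] at key
  · intro x y h
    have hne : (x : Plane) ≠ y := Subtype.coe_injective.ne h.ne
    have := one_le_edgeShare_add_inv
      (div_pos (influenceRadius_pos x.2 hne.symm) (influenceRadius_pos y.2 hne))
    rwa [inv_div] at this
  · intro x
    -- Positivity of the radius, needed for scaling, comes from the presence of a neighbor; without
    -- one the sum is empty.
    have hx : ∀ y ∈ (closedSphereOfInfluenceGraph V).neighborFinset x,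
        (closedSphereOfInfluenceGraph V).Adj x y ∧ (x : Plane) ≠ y ∧ 0 < influenceRadius V x := by
      intro y hy
      have h := (SimpleGraph.mem_neighborFinset _ x y).1 hy
      have hne : (x : Plane) ≠ y := Subtype.coe_injective.ne h.ne
      exact ⟨h, hne, influenceRadius_pos y.2 hne⟩
    set e := Complex.orthonormalBasisOneI.repr.symm
    set r := influenceRadius V x
    have hnorm : ∀ p : Plane, 0 < r → ‖e p / (r : ℂ)‖ = ‖p‖ / r := fun p hr => by
      rw [norm_div, LinearIsometryEquiv.norm_map, Complex.norm_real, Real.norm_of_nonneg hr.le]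
    refine sum_edgeShare_le _ (fun y : V => e ((y : Plane) - x) / (r : ℂ)) _ ?_ ?_ ?_ ?_
    · intro y hy
      obtain ⟨-, hne, hr⟩ := hx y hy
      rw [hnorm _ hr, one_le_div hr, ← dist_eq_norm, dist_comm]
      exact influenceRadius_le_dist y.2 hne
    · intro y hy
      obtain ⟨-, hne, hr⟩ := hx y hy
      rw [hnorm _ hr, ← dist_eq_norm]
      exact div_le_div_of_nonneg_right (influenceRadius_le_dist x.2 hne.symm) hr.le
    · intro y hy
      obtain ⟨h, -, hr⟩ := hx y hy
      rw [hnorm _ hr, ← dist_eq_norm, dist_comm, ← div_self hr.ne', ← add_div]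
      exact div_le_div_of_nonneg_right (dist_le_of_adj h) hr.le
    · intro y hy y' hy' hne
      obtain ⟨-, -, hr⟩ := hx y hy
      rw [← sub_div, ← map_sub, sub_sub_sub_cancel_right, hnorm _ hr, ← dist_eq_norm, dist_comm]
      exact div_le_div_of_nonneg_right
        (influenceRadius_le_dist y.2 (Subtype.coe_injective.ne hne.symm)) hr.le
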